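/- Let $\mathcal N$ be a finite nonempty set of $n$ agents and $\mathcal M$ a finite set of indivisible items. An allocation is a family $(S_i)_{i\in\mathcal N}$ of pairwise disjoint (possibly empty) subsets of $\mathcal M$ with $\bigcup_i S_i=\mathcal M$. Each agent $i$ has a valuation $v_i:2^{\mathcal M}\to\mathbb R_{\ge 0}$ with $v_i(\emptyset)=0$ that is monotone ($v_i(A)\le v_i(B)$ for $A\subseteq B$) and submodular ($v_i(A\cup\{g\})-v_i(A)\ge v_i(B\cup\{g\})-v_i(B)$ for $A\subseteq B$, $g\in\mathcal M\setminus B$). The maximin share of agent $i$ is $\mathsf{MMS}_i=\max_{(P_k)}\min_{k} v_i(P_k)$, where the maximum is over all divisions of $\mathcal M$ into $n$ pairwise disjoint, possibly empty bundles $P_1,\dots,P_n$ with union $\mathcal M$. Let $\varepsilon$ be a real number such that $v_i(\{j\})\le\varepsilon\cdot\mathsf{MMS}_i$ for every agent $i$ and every item $j$. Then there is an allocation $(A_i)_{i\in\mathcal N}$ such that $v_i(A_i)\ge\left(1-\tfrac1e-\varepsilon\right)\mathsf{MMS}_i$ for every agent $i$. -/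

import Mathlib

/-- Diminishing marginal returns: `f (A + g) - f A ≥ f (B + g) - f B` for `A ⊆ B` and `g ∉ B`. -/
def SubmodularFn {M : Type*} [DecidableEq M] (f : Finset M → ℝ) : Prop :=
  ∀ ⦃A B : Finset M⦄, A ⊆ B → ∀ g : M, g ∉ B → f (insert g B) - f B ≤ f (insert g A) - f A

/-- A valuation: a normalized monotone submodular set function on the items
(nonnegativity follows from normalization and monotonicity). -/
structure IsValuation {M : Type*} [DecidableEq M] (f : Finset M → ℝ) : Prop where
  empty : f ∅ = 0
  mono : ∀ ⦃A B : Finset M⦄, A ⊆ B → f A ≤ f B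
  submodular : SubmodularFn f

/-- An (integral) allocation of all the items `M` to the agents `N`: disjoint, possibly empty
bundles, one for each agent, that together contain every item. -/
structure IsAllocation {N M : Type*} (A : N → Finset M) : Prop where
  disjoint : ∀ ⦃i k : N⦄, i ≠ k → Disjoint (A i) (A k)
  cover : ∀ j : M, ∃ i : N, j ∈ A i

/-- The maximin share of a valuation `f`, for `n = |N|` agents: the maximum, over all divisions of
the items into `n` bundles (labelled by the agents), of the value of the worst bundle. -/
noncomputable def maximinShare (N : Type*) {M : Type*} (f : Finset M → ℝ) : ℝ :=
  ⨆ P : {P : N → Finset M // IsAllocation P}, ⨅ k : N, f (P.1 k)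

/-- For finitely many items and a finite nonempty set of agents, the maximin share is an attained
maximum of attained minima. -/
theorem maximinShare_isGreatest (N : Type*) {M : Type*} [Fintype N] [Nonempty N] [Fintype M]
    (f : Finset M → ℝ) :
    IsGreatest {t : ℝ | ∃ P : N → Finset M, IsAllocation P ∧
      IsLeast (Set.range fun k : N => f (P k)) t} (maximinShare N f) := by
  classical
  have key : ∀ P : N → Finset M,
      IsLeast (Set.range fun k : N => f (P k)) (⨅ k : N, f (P k)) := fun P =>
    ⟨Set.Nonempty.csInf_mem (Set.range_nonempty _) (Set.finite_range _), by
      rintro _ ⟨k, rfl⟩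
      exact ciInf_le (Set.finite_range _).bddBelow k⟩
  have hne : Nonempty {P : N → Finset M // IsAllocation P} := by
    obtain ⟨i₀⟩ := ‹Nonempty N›
    refine ⟨⟨fun i => if i = i₀ then Finset.univ else ∅, ⟨?_, fun j => ⟨i₀, by simp⟩⟩⟩⟩
    intro i k hik
    by_cases hi : i = i₀
    · have hk : k ≠ i₀ := fun h => hik (hi.trans h.symm)
      simp [hk]
    · simp [hi]
  constructor
  · obtain ⟨P, hP⟩ := Set.Nonempty.csSup_mem
      (Set.range_nonempty fun P : {P : N → Finset M // IsAllocation P} => ⨅ k : N, f (P.1 k))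
      (Set.finite_range _)
    refine ⟨P.1, P.2, ?_⟩
    have h := key P.1
    have hP' : (⨅ k : N, f (P.1 k)) = maximinShare N f := hP
    rwa [hP'] at h
  · rintro t ⟨P, hP, ht⟩
    rw [ht.unique (key P)]
    exact le_ciSup (f := fun P : {P : N → Finset M // IsAllocation P} => ⨅ k : N, f (P.1 k))
      (Set.finite_range _).bddAbove ⟨P, hP⟩

/-! Give every agent the fraction `1 / n` of every item and measure value by the multilinear
extension `F` of the valuation. Each of the `n` bundles of a maximin division can raise any set to
value at least `m`, the maximin share, so along the diagonal `F' ≥ n (m - F)`. Integrating up to `1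
/ n` gives `(1 - 1 / e) m` (`IsValuation.le_multilinearExt_uniform`).

Rounding (`IsFractionalAllocation.exists_rounding`) lowers the number of positive fractions step by
step. By submodularity `F` is convex along exchanges of one item against another, so fractions can
be shifted around a closed walk of agents without loss to anyone. An agent down to one proper
fraction surrenders it, at the cost of at most one item's value; no proper fraction ever returns to
this agent, so the loss occurs only once. -/

/-- The probability that independent draws, with item `j` drawn with probability `x j`, give
exactly the set `S`. -/
noncomputable def inclusionWeight {M : Type*} [Fintype M] [DecidableEq M] (x : M → ℝ)
    (S : Finset M) : ℝ :=
  ∏ j, if j ∈ S then x j else 1 - x j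

/-- The multilinear extension of a set function: its expectation under independent draws. -/
noncomputable def multilinearExt {M : Type*} [Fintype M] [DecidableEq M] (f : Finset M → ℝ)
    (x : M → ℝ) : ℝ :=
  ∑ S, inclusionWeight x S * f S

/-- The marginal contribution of `j` to a set, whether or not the set contains `j`. -/
def marginal {M : Type*} [DecidableEq M] (f : Finset M → ℝ) (j : M) (S : Finset M) : ℝ :=
  f (insert j S) - f (S.erase j)

/-! ### The multilinear extension and its derivatives. -/

section MultilinearExtension

variable {M : Type*} [Fintype M] [DecidableEq M]

theorem sum_finset_eq_sum_powerset_erase (j : M) (h : Finset M → ℝ) :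
    ∑ S, h S = ∑ S ∈ (Finset.univ.erase j).powerset, (h S + h (insert j S)) := by
  rw [Finset.sum_add_distrib, ← Finset.sum_powerset_insert (Finset.notMem_erase j _),
    Finset.insert_erase (Finset.mem_univ j), Finset.powerset_univ]

theorem inclusionWeight_eq_of_notMem (x : M → ℝ) {j : M} {S : Finset M} (hS : j ∉ S) :
    inclusionWeight x S =
      (1 - x j) * ∏ l ∈ Finset.univ.erase j, if l ∈ S then x l else 1 - x l := by
  rw [inclusionWeight, ← Finset.mul_prod_erase _ _ (Finset.mem_univ j), if_neg hS]

theorem inclusionWeight_insert (x : M → ℝ) (j : M) (S : Finset M) :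
    inclusionWeight x (insert j S) =
      x j * ∏ l ∈ Finset.univ.erase j, if l ∈ S then x l else 1 - x l := by
  rw [inclusionWeight, ← Finset.mul_prod_erase _ _ (Finset.mem_univ j),
    if_pos (Finset.mem_insert_self j S)]
  congr 1
  refine Finset.prod_congr rfl fun l hl => ?_
  simp [Finset.mem_insert, Finset.ne_of_mem_erase hl]

theorem multilinearExt_eq_sum_powerset_erase (f : Finset M → ℝ) (x : M → ℝ) (j : M) :
    multilinearExt f x = ∑ S ∈ (Finset.univ.erase j).powerset,
      (∏ l ∈ Finset.univ.erase j, if l ∈ S then x l else 1 - x l) *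
        ((1 - x j) * f S + x j * f (insert j S)) := by
  rw [multilinearExt, sum_finset_eq_sum_powerset_erase j]
  refine Finset.sum_congr rfl fun S hS => ?_
  have hj : j ∉ S := fun h => Finset.notMem_erase j _ (Finset.mem_powerset.1 hS h)
  rw [inclusionWeight_eq_of_notMem x hj, inclusionWeight_insert]
  ring

/-- The marginal ignores whether `j` is in the set, so the factor of `j` sums to one. The result is
the partial derivative of the extension in coordinate `j`. -/
theorem multilinearExt_marginal (f : Finset M → ℝ) (x : M → ℝ) (j : M) :
    multilinearExt (marginal f j) x = ∑ S ∈ (Finset.univ.erase j).powerset,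
      (∏ l ∈ Finset.univ.erase j, if l ∈ S then x l else 1 - x l) *
        (f (insert j S) - f S) := by
  rw [multilinearExt_eq_sum_powerset_erase _ x j]
  refine Finset.sum_congr rfl fun S hS => ?_
  have hj : j ∉ S := fun h => Finset.notMem_erase j _ (Finset.mem_powerset.1 hS h)
  simp only [marginal, Finset.insert_idem, Finset.erase_insert hj, Finset.erase_eq_of_notMem hj]
  ring

/-- The multilinear extension is affine in every coordinate. -/
theorem multilinearExt_add_single (f : Finset M → ℝ) (x : M → ℝ) (j : M) (s : ℝ) :
    multilinearExt f (x + Pi.single j s) =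
      multilinearExt f x + s * multilinearExt (marginal f j) x := by
  rw [multilinearExt_marginal, multilinearExt_eq_sum_powerset_erase f _ j,
    multilinearExt_eq_sum_powerset_erase f x j, Finset.mul_sum, ← Finset.sum_add_distrib]
  refine Finset.sum_congr rfl fun S _ => ?_
  have hprod : (∏ l ∈ Finset.univ.erase j, if l ∈ S then (x + Pi.single j s : M → ℝ) l
      else 1 - (x + Pi.single j s : M → ℝ) l) =
      ∏ l ∈ Finset.univ.erase j, if l ∈ S then x l else 1 - x l := by
    refine Finset.prod_congr rfl fun l hl => ?_
    simp [Pi.single_eq_of_ne (Finset.ne_of_mem_erase hl)]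
  rw [hprod, Pi.add_apply, Pi.single_eq_same]
  ring

theorem inclusionWeight_nonneg {x : M → ℝ} (h0 : ∀ j, 0 ≤ x j) (h1 : ∀ j, x j ≤ 1)
    (S : Finset M) : 0 ≤ inclusionWeight x S := by
  refine Finset.prod_nonneg fun j _ => ?_
  split_ifs
  · exact h0 j
  · linarith [h1 j]

theorem sum_inclusionWeight (x : M → ℝ) : ∑ S, inclusionWeight x S = 1 := by
  have h := Finset.prod_add x (fun j => 1 - x j) Finset.univ
  simp only [add_sub_cancel, Finset.prod_const_one, Finset.powerset_univ] at h
  rw [h]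
  refine Finset.sum_congr rfl fun S _ => ?_
  rw [inclusionWeight, Finset.prod_ite]
  congr 2 <;> ext <;> simp

theorem multilinearExt_const (c : ℝ) (x : M → ℝ) : multilinearExt (fun _ => c) x = c := by
  rw [multilinearExt, ← Finset.sum_mul, sum_inclusionWeight, one_mul]

theorem multilinearExt_mono {f g : Finset M → ℝ} (hfg : ∀ S, f S ≤ g S) {x : M → ℝ}
    (h0 : ∀ j, 0 ≤ x j) (h1 : ∀ j, x j ≤ 1) : multilinearExt f x ≤ multilinearExt g x :=
  Finset.sum_le_sum fun S _ =>
    mul_le_mul_of_nonneg_left (hfg S) (inclusionWeight_nonneg h0 h1 S)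

theorem multilinearExt_indicator (f : Finset M → ℝ) (A : Finset M) :
    multilinearExt f (fun j => if j ∈ A then 1 else 0) = f A := by
  rw [multilinearExt, Finset.sum_eq_single A]
  · rw [inclusionWeight, Finset.prod_eq_one, one_mul]
    intro j _
    by_cases hj : j ∈ A <;> simp [hj]
  · intro S _ hS
    obtain ⟨j, hj⟩ : ∃ j, ¬ (j ∈ S ↔ j ∈ A) := by
      by_contra! h
      exact hS (Finset.ext h)
    rw [inclusionWeight, Finset.prod_eq_zero (Finset.mem_univ j), zero_mul]
    by_cases hS : j ∈ S <;> by_cases hA : j ∈ A <;> simp_all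
  · simp

theorem hasDerivAt_multilinearExt_diagonal (f : Finset M → ℝ) (t : ℝ) :
    HasDerivAt (fun t => multilinearExt f (fun _ => t))
      (∑ j, multilinearExt (marginal f j) (fun _ => t)) t := by
  have hprod : ∀ S : Finset M, HasDerivAt (fun t : ℝ => inclusionWeight (fun _ => t) S)
      (∑ j, (∏ l ∈ Finset.univ.erase j, if l ∈ S then t else 1 - t) *
        (if j ∈ S then 1 else -1)) t := by
    intro S
    have h := HasDerivAt.fun_finsetProd (u := Finset.univ)
      (f := fun (j : M) (t : ℝ) => if j ∈ S then t else 1 - t)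
      (f' := fun j => if j ∈ S then 1 else -1) (x := t) (fun j _ => by
        by_cases hj : j ∈ S
        · simpa only [hj, if_true] using hasDerivAt_id' t
        · simpa only [hj, if_false] using (hasDerivAt_id' t).const_sub 1)
    simpa [inclusionWeight, smul_eq_mul] using h
  have hsum := HasDerivAt.fun_sum (u := Finset.univ) fun (S : Finset M) _ =>
    (hprod S).mul_const (f S)
  refine hsum.congr_deriv ?_
  simp only [Finset.sum_mul]
  rw [Finset.sum_comm]
  refine Finset.sum_congr rfl fun j _ => ?_
  rw [multilinearExt_marginal, sum_finset_eq_sum_powerset_erase j]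
  refine Finset.sum_congr rfl fun S hS => ?_
  have hj : j ∉ S := fun h => Finset.notMem_erase j _ (Finset.mem_powerset.1 hS h)
  have hprod : (∏ l ∈ Finset.univ.erase j, if l ∈ insert j S then t else 1 - t) =
      ∏ l ∈ Finset.univ.erase j, if l ∈ S then t else 1 - t := by
    refine Finset.prod_congr rfl fun l hl => ?_
    simp [Finset.mem_insert, Finset.ne_of_mem_erase hl]
  rw [hprod, if_neg hj, if_pos (Finset.mem_insert_self j S)]
  ring

end MultilinearExtension

/-! ### Submodularity, exchange convexity and the uniform fractional bound. -/

section Valuation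

variable {M : Type*} [DecidableEq M] {f : Finset M → ℝ}

theorem IsValuation.nonneg (hf : IsValuation f) (S : Finset M) : 0 ≤ f S :=
  hf.empty ▸ hf.mono (Finset.empty_subset S)

theorem IsValuation.marginal_nonneg (hf : IsValuation f) (j : M) (S : Finset M) :
    0 ≤ marginal f j S :=
  sub_nonneg.2 (hf.mono ((S.erase_subset j).trans (S.subset_insert j)))

theorem IsValuation.marginal_antitone (hf : IsValuation f) (j : M) {S T : Finset M}
    (hST : S ⊆ T) : marginal f j T ≤ marginal f j S := by
  have h := hf.submodular (Finset.erase_subset_erase j hST) j (Finset.notMem_erase j T)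
  have e : ∀ U : Finset M, insert j (U.erase j) = insert j U := fun U => by
    ext l
    by_cases hl : l = j <;> simp [hl]
  simpa only [marginal, e] using h

theorem IsValuation.marginal_le_singleton (hf : IsValuation f) (j : M) (S : Finset M) :
    marginal f j S ≤ f {j} := by
  have h := hf.marginal_antitone j (Finset.empty_subset S)
  simpa [marginal, hf.empty] using h

/-- Discrete form of the sign of the mixed second derivatives, the source of convexity along
exchanges. -/
theorem IsValuation.marginal_marginal_nonpos (hf : IsValuation f) (j k : M) (S : Finset M) :
    marginal (marginal f k) j S ≤ 0 :=
  sub_nonpos.2 (hf.marginal_antitone k ((S.erase_subset j).trans (S.subset_insert j)))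

theorem IsValuation.union_sub_le_sum_marginal (hf : IsValuation f) (S P : Finset M) :
    f (S ∪ P) - f S ≤ ∑ j ∈ P, marginal f j S := by
  induction P using Finset.induction_on with
  | empty => simp
  | insert j P hj ih =>
    rw [Finset.sum_insert hj, Finset.union_insert]
    have h1 : f (insert j (S ∪ P)) - f (S ∪ P) ≤ marginal f j (S ∪ P) :=
      sub_le_sub_left (hf.mono (Finset.erase_subset j _)) _
    have h2 := hf.marginal_antitone j (Finset.subset_union_left (s₁ := S) (s₂ := P))
    linarith

variable [Fintype M]

theorem IsValuation.multilinearExt_marginal_nonneg (hf : IsValuation f) {x : M → ℝ}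
    (h0 : ∀ j, 0 ≤ x j) (h1 : ∀ j, x j ≤ 1) (j : M) :
    0 ≤ multilinearExt (marginal f j) x := by
  have h := multilinearExt_mono (f := fun _ => 0) (hf.marginal_nonneg j) h0 h1
  rwa [multilinearExt_const] at h

theorem IsValuation.multilinearExt_marginal_le (hf : IsValuation f) {x : M → ℝ}
    (h0 : ∀ j, 0 ≤ x j) (h1 : ∀ j, x j ≤ 1) (j : M) :
    multilinearExt (marginal f j) x ≤ f {j} := by
  have h := multilinearExt_mono (g := fun _ => f {j}) (hf.marginal_le_singleton j) h0 h1
  rwa [multilinearExt_const] at h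

/-- Along an exchange direction, the multilinear extension lies above its tangent. -/
theorem IsValuation.le_multilinearExt_exchange (hf : IsValuation f) {x : M → ℝ}
    (h0 : ∀ j, 0 ≤ x j) (h1 : ∀ j, x j ≤ 1) (j k : M) {α β : ℝ} (hα : 0 ≤ α) (hβ : 0 ≤ β) :
    multilinearExt f x + (α * multilinearExt (marginal f j) x -
        β * multilinearExt (marginal f k) x) ≤
      multilinearExt f (x + (Pi.single j α - Pi.single k β)) := by
  have e : x + (Pi.single j α - Pi.single k β) =
      x + Pi.single j α + Pi.single k (-β) := by
    rw [Pi.single_neg]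
    abel
  have h : multilinearExt (marginal (marginal f k) j) x ≤ 0 := by
    have h := multilinearExt_mono (g := fun _ => 0) (hf.marginal_marginal_nonpos j k) h0 h1
    rwa [multilinearExt_const] at h
  -- Affinity in each coordinate leaves exactly one term beyond the tangent: `-α * β` times the
  -- mixed derivative, which is nonnegative.
  rw [e, multilinearExt_add_single, multilinearExt_add_single, multilinearExt_add_single]
  nlinarith [mul_nonneg hα hβ]

/-- If the items split into `n` bundles of value at least `m`, then a random set containing each
item independently with probability `1 / n` has expected value at least `(1 - 1 / e) m`. -/
theorem IsValuation.le_multilinearExt_uniform {N : Type*} [Fintype N] [Nonempty N]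
    (hf : IsValuation f) {P : N → Finset M} (hP : IsAllocation P) {m : ℝ}
    (hm : ∀ k, m ≤ f (P k)) :
    (1 - 1 / Real.exp 1) * m ≤ multilinearExt f (fun _ => 1 / (Fintype.card N : ℝ)) := by
  set n : ℝ := (Fintype.card N : ℝ) with hn
  have hn1 : 1 ≤ n := by
    rw [hn]
    exact_mod_cast Fintype.card_pos (α := N)
  have hn0 : 0 < n := by linarith
  set φ : ℝ → ℝ := fun t => multilinearExt f (fun _ => t) with hφ
  have hsum : ∀ h : M → ℝ, ∑ j, h j = ∑ k, ∑ j ∈ P k, h j := by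
    intro h
    rw [← Finset.sum_biUnion fun i _ k _ hik => hP.disjoint hik]
    refine Finset.sum_congr (Eq.symm (Finset.eq_univ_of_forall fun j => ?_)) fun _ _ => rfl
    obtain ⟨i, hi⟩ := hP.cover j
    exact Finset.mem_biUnion.2 ⟨i, Finset.mem_univ i, hi⟩
  -- Adding any bundle `P k` to `S` reaches value at least `m`; sum over the `n` bundles.
  have hset : ∀ S, n * (m - f S) ≤ ∑ j, marginal f j S := by
    intro S
    rw [hsum]
    have h : ∀ k ∈ Finset.univ, m - f S ≤ ∑ j ∈ P k, marginal f j S := fun k _ =>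
      (sub_le_sub_right ((hm k).trans (hf.mono Finset.subset_union_right)) _).trans
        (hf.union_sub_le_sum_marginal S (P k))
    simpa only [Finset.sum_const, Finset.card_univ, nsmul_eq_mul] using Finset.sum_le_sum h
  have hderiv : ∀ t, 0 ≤ t → t ≤ 1 →
      n * (m - φ t) ≤ ∑ j, multilinearExt (marginal f j) (fun _ => t) := by
    intro t h0 h1
    have h := multilinearExt_mono hset (x := fun _ => t) (fun _ => h0) (fun _ => h1)
    have e1 : multilinearExt (fun S => n * (m - f S)) (fun _ => t) = n * (m - φ t) := by
      have := multilinearExt_const m (fun _ : M => t)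
      simp only [multilinearExt] at this
      simp only [multilinearExt, hφ]
      rw [← this, ← Finset.sum_sub_distrib, Finset.mul_sum]
      refine Finset.sum_congr rfl fun S _ => ?_
      rw [this]
      ring
    have e2 : multilinearExt (fun S => ∑ j, marginal f j S) (fun _ => t) =
        ∑ j, multilinearExt (marginal f j) (fun _ => t) := by
      simp only [multilinearExt, Finset.mul_sum]
      exact Finset.sum_comm
    rwa [e1, e2] at h
  -- The integrating factor `exp (n * t)` turns the differential inequality into monotonicity; at `t
  -- = 1 / n` it equals `e`.
  have hψ : ∀ t, HasDerivAt (fun t => Real.exp (n * t) * (m - φ t))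
      (Real.exp (n * t) * n * (m - φ t) +
        Real.exp (n * t) * -∑ j, multilinearExt (marginal f j) (fun _ => t)) t := by
    intro t
    have he : HasDerivAt (fun t : ℝ => Real.exp (n * t)) (Real.exp (n * t) * n) t := by
      simpa using ((hasDerivAt_id t).const_mul n).exp
    exact he.mul ((hasDerivAt_multilinearExt_diagonal f t).const_sub m)
  have hanti : AntitoneOn (fun t => Real.exp (n * t) * (m - φ t)) (Set.Icc 0 1) := by
    refine antitoneOn_of_deriv_nonpos (convex_Icc 0 1)
      (fun t _ => (hψ t).continuousAt.continuousWithinAt)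
      (fun t _ => (hψ t).differentiableAt.differentiableWithinAt) fun t ht => ?_
    rw [interior_Icc] at ht
    rw [(hψ t).deriv]
    have := mul_le_mul_of_nonneg_left (hderiv t ht.1.le ht.2.le) (Real.exp_pos (n * t)).le
    linarith
  have hφ0 : φ 0 = 0 := by
    have h := multilinearExt_indicator f ∅
    simpa [hf.empty] using h
  have hle := hanti (Set.left_mem_Icc.2 zero_le_one)
    (Set.mem_Icc.2 ⟨by positivity, (div_le_one hn0).2 hn1⟩) (by positivity : (0 : ℝ) ≤ 1 / n)
  simp only [mul_zero, Real.exp_zero, one_mul, hφ0, sub_zero, mul_one_div_cancel hn0.ne'] at hle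
  have he := Real.exp_pos 1
  have h2 : m - φ (1 / n) ≤ m / Real.exp 1 := by
    rw [le_div_iff₀ he]
    linarith
  have h3 : (1 - 1 / Real.exp 1) * m = m - m / Real.exp 1 := by ring
  rw [h3]
  linarith

end Valuation

/-! ### Closed walks and lossless exchange directions. -/

section Exchange

variable {N M : Type*}

/-- If every element of a nonempty bipartite relation has, at the same item, another agent that
has another item, then the relation contains a closed walk that visits its agents only once. -/
theorem exists_closed_walk [Finite N] (E : N → M → Prop) (hne : ∃ i j, E i j)
    (hE : ∀ i j, E i j → ∃ i' j', i' ≠ i ∧ j' ≠ j ∧ E i' j ∧ E i' j') :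
    ∃ (d : ℕ) (a : ℕ → N) (b : ℕ → M), 2 ≤ d ∧ a d = a 0 ∧ Set.InjOn a (Set.Iio d) ∧
      (∀ t, E (a t) (b t)) ∧ (∀ t, E (a (t + 1)) (b t)) ∧ ∀ t, b (t + 1) ≠ b t := by
  classical
  obtain ⟨i₀, j₀, h₀⟩ := hne
  choose! I J hI hJ hIE hIJ using hE
  let e : ℕ → N × M := fun t => (fun p : N × M => (I p.1 p.2, J p.1 p.2))^[t] (i₀, j₀)
  have hs : ∀ t, e (t + 1) = (I (e t).1 (e t).2, J (e t).1 (e t).2) := fun t =>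
    Function.iterate_succ_apply' _ _ _
  have he : ∀ t, E (e t).1 (e t).2 := by
    intro t
    induction t with
    | zero => exact h₀
    | succ t ih =>
      rw [hs]
      exact hIJ _ _ ih
  -- Agents recur by pigeonhole. Taking the least return time over all starting points makes the
  -- agents within one period distinct; items may still repeat.
  have hex : ∃ d, 0 < d ∧ ∃ p, (e (p + d)).1 = (e p).1 := by
    obtain ⟨p, q, hpq, h⟩ := Finite.exists_ne_map_eq_of_infinite fun t => (e t).1
    rcases lt_or_gt_of_ne hpq with hlt | hlt
    · exact ⟨q - p, by omega, p, by rw [Nat.add_sub_cancel' hlt.le]; exact h.symm⟩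
    · exact ⟨p - q, by omega, q, by rw [Nat.add_sub_cancel' hlt.le]; exact h⟩
  obtain ⟨hd, p, hp⟩ := Nat.find_spec hex
  have hmin : ∀ d', d' < Nat.find hex → ¬ (0 < d' ∧ ∃ p, (e (p + d')).1 = (e p).1) :=
    fun d' h => Nat.find_min hex h
  set d := Nat.find hex
  have hlt : ∀ s t, s < t → t < d → (e (p + s)).1 ≠ (e (p + t)).1 := by
    intro s t hst ht h
    refine hmin (t - s) (by omega) ⟨by omega, p + s, ?_⟩
    rw [show p + s + (t - s) = p + t by omega]
    exact h.symm
  refine ⟨d, fun t => (e (p + t)).1, fun t => (e (p + t)).2, ?_, hp, ?_, fun t => he _, ?_, ?_⟩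
  · by_contra! h
    have h1 : d = 1 := by omega
    rw [h1, hs] at hp
    exact hI _ _ (he p) hp
  · intro s hs' t ht' h
    rcases lt_trichotomy s t with hst | hst | hst
    · exact absurd h (hlt s t hst ht')
    · exact hst
    · exact absurd h.symm (hlt t s hst hs')
  · intro t
    beta_reduce
    rw [← add_assoc, hs]
    exact hIE _ _ (he _)
  · intro t
    beta_reduce
    rw [← add_assoc, hs]
    exact hJ _ _ (he _)

variable [Fintype N] [DecidableEq M]

/-- A nonzero direction, supported on a relation, that keeps the total of every item and exchanges
for every agent at most one item against another, at the rates `D` without loss to first order. -/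
theorem exists_exchange_direction (E : N → M → Prop) (hne : ∃ i j, E i j)
    (hE : ∀ i j, E i j → ∃ i' j', i' ≠ i ∧ j' ≠ j ∧ E i' j ∧ E i' j')
    (D : N → M → ℝ) (hD : ∀ i j, E i j → 0 < D i j) :
    ∃ z : N → M → ℝ, (∃ i j, z i j ≠ 0) ∧ (∀ i j, z i j ≠ 0 → E i j) ∧
      (∀ j, ∑ i, z i j = 0) ∧
      ∀ i, z i = 0 ∨ ∃ (α β : ℝ) (j k : M), 0 ≤ α ∧ 0 ≤ β ∧
        z i = Pi.single j α - Pi.single k β ∧ 0 ≤ α * D i j - β * D i k := by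
  classical
  obtain ⟨d, a, b, hd, had, hinj, hout, hin, hb⟩ := exists_closed_walk E hne hE
  -- Agent `a (t + 1)` receives `b t` and gives `b (t + 1)`; the recursion makes this break even to
  -- first order.
  let δ : ℕ → ℝ := fun t => Nat.rec 1
    (fun t x => x * D (a (t + 1)) (b t) / D (a (t + 1)) (b (t + 1))) t
  have hδs : ∀ t, δ (t + 1) = δ t * D (a (t + 1)) (b t) / D (a (t + 1)) (b (t + 1)) :=
    fun t => rfl
  have hδ : ∀ t, 0 < δ t := by
    intro t
    induction t with
    | zero => exact one_pos
    | succ t ih =>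
      rw [hδs]
      exact div_pos (mul_pos ih (hD _ _ (hin t))) (hD _ _ (hout (t + 1)))
  -- The amount `δ s` of item `b s` passes from `a s` to `a (s + 1)`.
  let z : N → M → ℝ := fun i => ∑ s ∈ Finset.range d,
    ((if i = a (s + 1) then Pi.single (b s) (δ s) else 0) -
      (if i = a s then Pi.single (b s) (δ s) else 0))
  have hz : ∀ r s, r < d → s < d → a (r + 1) = a s →
      z (a s) = Pi.single (b r) (δ r) - Pi.single (b s) (δ s) := by
    intro r s hr hs hrs
    have hinj' : ∀ t, t < d → a (t + 1) = a s → t = r := by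
      intro t ht h
      have key : ∀ u, u < d → ∃ u', u' < d ∧ a (u + 1) = a u' ∧
          (u' = u + 1 ∨ u + 1 = d ∧ u' = 0) := by
        intro u hu
        rcases Nat.lt_or_ge (u + 1) d with h | h
        · exact ⟨u + 1, h, rfl, Or.inl rfl⟩
        · have : u + 1 = d := by omega
          exact ⟨0, by omega, by rw [this, had], Or.inr ⟨this, rfl⟩⟩
      obtain ⟨u, hu, hu1, hu2⟩ := key t ht
      obtain ⟨w, hw, hw1, hw2⟩ := key r hr
      have : u = w := hinj hu hw (by rw [← hu1, ← hw1, h, hrs])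
      omega
    simp only [z]
    rw [Finset.sum_sub_distrib, Finset.sum_eq_single_of_mem r (Finset.mem_range.2 hr),
      Finset.sum_eq_single_of_mem s (Finset.mem_range.2 hs), if_pos hrs.symm, if_pos rfl]
    · intro t ht hts
      rw [if_neg fun h => hts (hinj hs (Finset.mem_range.1 ht) h).symm]
    · intro t ht htr
      rw [if_neg fun h => htr (hinj' t (Finset.mem_range.1 ht) h.symm)]
  have hz0 : ∀ i, (∀ s, s < d → a s ≠ i) → z i = 0 := by
    intro i hi
    refine Finset.sum_eq_zero fun s hs => ?_
    have hs' := Finset.mem_range.1 hs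
    rw [if_neg (hi s hs').symm, if_neg, sub_zero]
    rcases Nat.lt_or_ge (s + 1) d with h | h
    · exact (hi _ h).symm
    · rw [show s + 1 = d by omega, had]
      exact (hi 0 (by omega)).symm
  obtain ⟨d', rfl⟩ : ∃ d', d = d' + 1 := ⟨d - 1, by omega⟩
  -- At `a 0`, where the walk closes, `b d'` and `b 0` may be the same item; the exchange form
  -- allows this.
  have hcases : ∀ i, z i = 0 ∨
      (∃ r, i = a (r + 1) ∧ z i = Pi.single (b r) (δ r) - Pi.single (b (r + 1)) (δ (r + 1))) ∨
      (i = a 0 ∧ z i = Pi.single (b d') (δ d') - Pi.single (b 0) (δ 0)) := by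
    intro i
    by_cases hi : ∃ s, s < d' + 1 ∧ a s = i
    · obtain ⟨s, hs, rfl⟩ := hi
      cases s with
      | zero => exact Or.inr (Or.inr ⟨rfl, hz d' 0 (by omega) hs had⟩)
      | succ r => exact Or.inr (Or.inl ⟨r, rfl, hz r (r + 1) (by omega) hs rfl⟩)
    · push Not at hi
      exact Or.inl (hz0 i hi)
  have hbal : ∀ r, δ r * D (a (r + 1)) (b r) - δ (r + 1) * D (a (r + 1)) (b (r + 1)) = 0 := by
    intro r
    rw [hδs, div_mul_cancel₀ _ (hD _ _ (hout (r + 1))).ne', sub_self]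
  have hnz : z (a 1) (b 0) ≠ 0 := by
    rw [hz 0 1 (by omega) (by omega) rfl]
    simp [Pi.single_eq_of_ne (hb 0).symm, (hδ 0).ne']
  have hsupp : ∀ i j, z i j ≠ 0 → E i j := by
    have aux : ∀ (j k l : M) (x y : ℝ),
        (Pi.single j x - Pi.single k y : M → ℝ) l ≠ 0 → l = j ∨ l = k := by
      intro j k l x y h
      by_contra! h'
      exact h (by simp [Pi.single_eq_of_ne h'.1, Pi.single_eq_of_ne h'.2])
    intro i j hij
    rcases hcases i with h | ⟨r, hi, h⟩ | ⟨hi, h⟩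
    · exact absurd (congrFun h j) hij
    · rw [h] at hij
      rcases aux _ _ _ _ _ hij with rfl | rfl
      · exact hi ▸ hin r
      · exact hi ▸ hout (r + 1)
    · rw [h] at hij
      rcases aux _ _ _ _ _ hij with rfl | rfl
      · rw [hi, ← had]
        exact hin d'
      · exact hi ▸ hout 0
  have hcol : ∀ j, ∑ i, z i j = 0 := by
    intro j
    simp only [z, Finset.sum_apply, Pi.sub_apply]
    rw [Finset.sum_comm]
    refine Finset.sum_eq_zero fun s _ => ?_
    have : ∀ k : N, ∑ i, (if i = k then Pi.single (b s) (δ s) else 0 : M → ℝ) j =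
        (Pi.single (b s) (δ s) : M → ℝ) j := by
      intro k
      rw [Finset.sum_eq_single k] <;> simp +contextual
    rw [Finset.sum_sub_distrib, this, this, sub_self]
  -- Only `a 0` can be unbalanced. If it loses, reversing the whole direction makes it gain and
  -- keeps the others balanced.
  rcases le_total 0 (δ d' * D (a 0) (b d') - δ 0 * D (a 0) (b 0)) with hQ | hQ
  · refine ⟨z, ⟨_, _, hnz⟩, hsupp, hcol, fun i => ?_⟩
    rcases hcases i with h | ⟨r, rfl, h⟩ | ⟨rfl, h⟩
    · exact Or.inl h
    · exact Or.inr ⟨δ r, δ (r + 1), b r, b (r + 1), (hδ r).le, (hδ (r + 1)).le, h, (hbal r).ge⟩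
    · exact Or.inr ⟨δ d', δ 0, b d', b 0, (hδ d').le, (hδ 0).le, h, hQ⟩
  · refine ⟨-z, ⟨a 1, b 0, neg_ne_zero.2 hnz⟩, fun i j h => hsupp i j (neg_ne_zero.1 h),
      fun j => by simp [hcol j], fun i => ?_⟩
    rcases hcases i with h | ⟨r, rfl, h⟩ | ⟨rfl, h⟩
    · exact Or.inl (by simp [h])
    · exact Or.inr ⟨δ (r + 1), δ r, b (r + 1), b r, (hδ (r + 1)).le, (hδ r).le,
        by rw [Pi.neg_apply, h, neg_sub],
        by linarith [hbal r]⟩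
    · exact Or.inr ⟨δ 0, δ d', b 0, b d', (hδ 0).le, (hδ d').le,
        by rw [Pi.neg_apply, h, neg_sub],
        by linarith⟩

end Exchange

/-! ### Rounding fractional allocations. -/

/-- A division of every item into fractions, one for each agent. -/
structure IsFractionalAllocation {N M : Type*} [Fintype N] (y : N → M → ℝ) : Prop where
  nonneg : ∀ i j, 0 ≤ y i j
  sum_eq_one : ∀ j, ∑ i, y i j = 1

section Rounding

variable {N M : Type*} [Fintype N]

theorem IsFractionalAllocation.le_one {y : N → M → ℝ} (hy : IsFractionalAllocation y) (i : N)
    (j : M) : y i j ≤ 1 :=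
  hy.sum_eq_one j ▸ Finset.single_le_sum (f := fun i => y i j) (fun k _ => hy.nonneg k j)
    (Finset.mem_univ i)

theorem IsFractionalAllocation.exists_ne_pos {y : N → M → ℝ} (hy : IsFractionalAllocation y)
    {i : N} {j : M} (hij : y i j < 1) : ∃ k, k ≠ i ∧ 0 < y k j := by
  by_contra! h
  have hs := hy.sum_eq_one j
  rw [Finset.sum_eq_single i (fun k _ hk => le_antisymm (h k hk) (hy.nonneg k j)) (by simp)] at hs
  exact hij.ne hs

theorem IsFractionalAllocation.add_le_one {y : N → M → ℝ} (hy : IsFractionalAllocation y)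
    {i k : N} (hik : i ≠ k) (j : M) : y i j + y k j ≤ 1 := by
  classical
  have h := Finset.sum_le_sum_of_subset_of_nonneg (f := fun i => y i j)
    (Finset.subset_univ {i, k}) fun l _ _ => hy.nonneg l j
  rwa [hy.sum_eq_one j, Finset.sum_pair hik] at h

variable [Fintype M]

open Classical in
/-- The number of positive fractions. -/
noncomputable def supportCard (y : N → M → ℝ) : ℕ :=
  (Finset.univ.filter fun e : N × M => 0 < y e.1 e.2).card

theorem supportCard_lt {y y' : N → M → ℝ} (h : ∀ i j, 0 < y' i j → 0 < y i j) {i : N} {j : M}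
    (hy : 0 < y i j) (hy' : ¬ 0 < y' i j) : supportCard y' < supportCard y := by
  classical
  refine Finset.card_lt_card (Finset.ssubset_iff_of_subset ?_ |>.2 ⟨(i, j), ?_, ?_⟩)
  · intro e he
    simp only [Finset.mem_filter, Finset.mem_univ, true_and] at he ⊢
    exact h _ _ he
  · simpa using hy
  · simpa using hy'

/-- Moving in a direction that keeps the total of every item until a fraction vanishes. -/
theorem IsFractionalAllocation.exists_add_smul {y z : N → M → ℝ}
    (hy : IsFractionalAllocation y) (hz : ∃ i j, z i j ≠ 0)
    (hzy : ∀ i j, z i j ≠ 0 → 0 < y i j) (hsum : ∀ j, ∑ i, z i j = 0) :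
    ∃ t : ℝ, 0 ≤ t ∧ IsFractionalAllocation (y + t • z) ∧
      supportCard (y + t • z) < supportCard y := by
  classical
  -- Zero item totals force a nonzero direction to have a negative entry; the least ratio over such
  -- entries is the first time a fraction vanishes.
  have hneg : (Finset.univ.filter fun e : N × M => z e.1 e.2 < 0).Nonempty := by
    obtain ⟨i, j, hij⟩ := hz
    by_contra h
    have h0 : ∀ k, 0 ≤ z k j := by
      intro k
      by_contra! hk
      exact h ⟨(k, j), by simpa using hk⟩
    exact hij ((Finset.sum_eq_zero_iff_of_nonneg fun k _ => h0 k).1 (hsum j) i (Finset.mem_univ i))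
  obtain ⟨⟨i, j⟩, hmem, hmin⟩ := Finset.exists_min_image _
    (fun e : N × M => y e.1 e.2 / -z e.1 e.2) hneg
  simp only [Finset.mem_filter, Finset.mem_univ, true_and] at hmem hmin
  have ht : 0 ≤ y i j / -z i j := div_nonneg (hy.nonneg i j) (by linarith)
  refine ⟨y i j / -z i j, ht, ⟨fun k l => ?_, fun l => ?_⟩, ?_⟩
  · simp only [Pi.add_apply, Pi.smul_apply, smul_eq_mul]
    rcases lt_or_ge (z k l) 0 with h | h
    · have := (le_div_iff₀ (by linarith : 0 < -z k l)).1 (hmin (k, l) h)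
      linarith
    · have := hy.nonneg k l
      positivity
  · simp only [Pi.add_apply, Pi.smul_apply, smul_eq_mul]
    rw [Finset.sum_add_distrib, ← Finset.mul_sum, hsum, mul_zero, add_zero, hy.sum_eq_one]
  · refine supportCard_lt (i := i) (j := j) (fun k l h => ?_) (hzy i j hmem.ne) ?_
    · by_cases hkl : z k l = 0
      · simpa [hkl] using h
      · exact hzy k l hkl
    · simp only [Pi.add_apply, Pi.smul_apply, smul_eq_mul]
      have : y i j / -z i j * z i j = - y i j := by
        field_simp [hmem.ne]
      rw [this]
      simp

variable [DecidableEq M] {v : N → Finset M → ℝ}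

/-- A fractional allocation can be rounded so that agents without a proper fraction lose nothing,
and the other agents lose at most the value of one item. -/
theorem IsFractionalAllocation.exists_rounding (hv : ∀ i, IsValuation (v i)) {c : N → ℝ}
    (hc : ∀ i j, v i {j} ≤ c i) {y : N → M → ℝ} (hy : IsFractionalAllocation y) :
    ∃ A : N → Finset M, IsAllocation A ∧ ∀ i,
      multilinearExt (v i) (y i) ≤ v i (A i) ∨
        (∃ j, 0 < y i j ∧ y i j < 1) ∧ multilinearExt (v i) (y i) - c i ≤ v i (A i) := by
  classical
  induction hn : supportCard y using Nat.strong_induction_on generalizing y with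
  | _ n ih =>
  subst hn
  by_cases hint : ∀ i j, ¬ (0 < y i j ∧ y i j < 1)
  · have h01 : ∀ i j, y i j = if y i j = 1 then 1 else 0 := by
      intro i j
      split_ifs with h
      · exact h
      · by_contra h0
        exact hint i j ⟨(hy.nonneg i j).lt_of_ne' h0, (hy.le_one i j).lt_of_ne h⟩
    refine ⟨fun i => Finset.univ.filter fun j => y i j = 1, ⟨fun i k hik => ?_, fun j => ?_⟩,
      fun i => Or.inl ?_⟩
    · refine Finset.disjoint_left.2 fun j hi hk => ?_
      simp only [Finset.mem_filter, Finset.mem_univ, true_and] at hi hk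
      linarith [hy.add_le_one hik j]
    · by_contra! h
      have hs := hy.sum_eq_one j
      rw [Finset.sum_eq_zero fun i _ => ?_] at hs
      · exact zero_ne_one hs
      · have := h i
        simp only [Finset.mem_filter, Finset.mem_univ, true_and] at this
        rw [h01, if_neg this]
    · rw [← multilinearExt_indicator (v i)]
      refine le_of_eq (congrArg _ (funext fun j => ?_))
      simpa using h01 i j
  push Not at hint
  -- A proper fraction is handed over outright if it is worthless at the margin or is its owner's
  -- only one.
  by_cases htrans : ∃ i j, 0 < y i j ∧ y i j < 1 ∧
      (multilinearExt (marginal (v i) j) (y i) = 0 ∨ ∀ l, 0 < y i l → y i l < 1 → l = j)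
  · obtain ⟨i, j, hpos, hlt, hor⟩ := htrans
    obtain ⟨k, hki, hk⟩ := hy.exists_ne_pos hlt
    let y' : N → M → ℝ := Function.update (Function.update y i (y i + Pi.single j (-y i j))) k
      (y k + Pi.single j (y i j))
    have hyi : y' i = y i + Pi.single j (-y i j) := by
      simp [y', Function.update_of_ne hki.symm]
    have hyk : y' k = y k + Pi.single j (y i j) := by simp [y']
    have hyl : ∀ l, l ≠ i → l ≠ k → y' l = y l := fun l hli hlk => by
      simp [y', Function.update_of_ne hli, Function.update_of_ne hlk]
    have hyij : y' i j = 0 := by simp [hyi]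
    have hne : ∀ l m, m ≠ j → y' l m = y l m := by
      intro l m hm
      by_cases hli : l = i
      · subst hli
        simp [hyi, Pi.single_eq_of_ne hm]
      · by_cases hlk : l = k
        · subst hlk
          simp [hyk, Pi.single_eq_of_ne hm]
        · rw [hyl l hli hlk]
    have hykj : y' k j = y k j + y i j := by simp [hyk]
    have hy' : IsFractionalAllocation y' := by
      refine ⟨fun l m => ?_, fun m => ?_⟩
      · by_cases hm : m = j
        · subst hm
          by_cases hli : l = i
          · rw [hli, hyij]
          · by_cases hlk : l = k
            · rw [hlk, hykj]
              positivity
            · rw [hyl l hli hlk]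
              exact hy.nonneg l m
        · rw [hne l m hm]
          exact hy.nonneg l m
      · rw [← hy.sum_eq_one m]
        by_cases hm : m = j
        · subst hm
          rw [← Finset.add_sum_erase _ _ (Finset.mem_univ i),
            ← Finset.add_sum_erase _ (fun l => y l m) (Finset.mem_univ i),
            ← Finset.add_sum_erase _ _ (Finset.mem_erase.2 ⟨hki, Finset.mem_univ k⟩),
            ← Finset.add_sum_erase _ (fun l => y l m)
              (Finset.mem_erase.2 ⟨hki, Finset.mem_univ k⟩), hyij, hykj]
          rw [Finset.sum_congr rfl fun l hl => congrFun
            (hyl l (Finset.ne_of_mem_erase (Finset.mem_of_mem_erase hl))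
              (Finset.ne_of_mem_erase hl)) m]
          ring
        · exact Finset.sum_congr rfl fun l _ => hne l m hm
    have hactive : ∀ l m, 0 < y' l m → y' l m < 1 → 0 < y l m ∧ y l m < 1 := by
      intro l m h0 h1
      by_cases hm : m = j
      · subst hm
        by_cases hli : l = i
        · rw [hli, hyij] at h0
          exact absurd h0 (lt_irrefl 0)
        · by_cases hlk : l = k
          · rw [hlk, hykj] at h1
            rw [hlk]
            exact ⟨hk, by linarith⟩
          · rw [hyl l hli hlk] at h0 h1
            exact ⟨h0, h1⟩
      · rw [hne l m hm] at h0 h1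
        exact ⟨h0, h1⟩
    have hcard : supportCard y' < supportCard y := by
      refine supportCard_lt (i := i) (j := j) (fun l m h => ?_) hpos (by rw [hyij]; simp)
      by_cases hm : m = j
      · subst hm
        by_cases hli : l = i
        · rwa [hli]
        · by_cases hlk : l = k
          · rwa [hlk]
          · rwa [hyl l hli hlk] at h
      · rwa [hne l m hm] at h
    obtain ⟨A, hA, hAv⟩ := ih _ hcard hy' rfl
    refine ⟨A, hA, fun l => ?_⟩
    by_cases hli : l = i
    · subst hli
      have hext : multilinearExt (v l) (y' l) = multilinearExt (v l) (y l) -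
          y l j * multilinearExt (marginal (v l) j) (y l) := by
        rw [hyi, multilinearExt_add_single]
        ring
      have hAl := hAv l
      rw [hext] at hAl
      rcases hor with h0 | honly
      · rw [h0, mul_zero, sub_zero] at hAl
        exact hAl.imp id fun ⟨⟨m, hm0, hm1⟩, h⟩ => ⟨⟨m, hactive l m hm0 hm1⟩, h⟩
      -- Now this agent has no proper fraction left, so the induction hypothesis excludes any
      -- further loss.
      · have hAl' := hAl.resolve_right fun ⟨⟨m, hm0, hm1⟩, _⟩ => by
          have hm := hactive l m hm0 hm1
          rw [honly m hm.1 hm.2, hyij] at hm0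
          exact lt_irrefl 0 hm0
        refine Or.inr ⟨⟨j, hpos, hlt⟩, le_trans ?_ hAl'⟩
        have h1 := (hv l).multilinearExt_marginal_nonneg (hy.nonneg l) (hy.le_one l) j
        have h2 := ((hv l).multilinearExt_marginal_le (hy.nonneg l) (hy.le_one l) j).trans
          (hc l j)
        nlinarith
    · have hext : multilinearExt (v l) (y l) ≤ multilinearExt (v l) (y' l) := by
        by_cases hlk : l = k
        · subst hlk
          rw [hyk, multilinearExt_add_single]
          have h1 := (hv l).multilinearExt_marginal_nonneg (hy.nonneg l) (hy.le_one l) j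
          have := mul_nonneg hpos.le h1
          linarith
        · rw [hyl l hli hlk]
      exact (hAv l).imp hext.trans fun ⟨⟨m, hm0, hm1⟩, h⟩ =>
        ⟨⟨m, hactive l m hm0 hm1⟩, by linarith⟩
  -- Every owner of a proper fraction now has a second one, and all rates are positive, as the
  -- closed walk and its exchange amounts require.
  · push Not at htrans
    obtain ⟨z, hz0, hzE, hsum, hz⟩ := exists_exchange_direction
      (fun i j => 0 < y i j ∧ y i j < 1) hint
      (fun i j hij => by
        obtain ⟨k, hki, hk⟩ := hy.exists_ne_pos hij.2
        have hk1 : y k j < 1 := by linarith [hy.add_le_one hki j, hij.1]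
        obtain ⟨l, hl0, hl1, hlj⟩ := (htrans k j hk hk1).2
        exact ⟨k, l, hki, hlj, ⟨hk, hk1⟩, hl0, hl1⟩)
      (fun i j => multilinearExt (marginal (v i) j) (y i))
      (fun i j hij => ((hv i).multilinearExt_marginal_nonneg (hy.nonneg i) (hy.le_one i)
        j).lt_of_ne' (htrans i j hij.1 hij.2).1)
    obtain ⟨t, ht, hyt, hcard⟩ := hy.exists_add_smul hz0 (fun i j h => (hzE i j h).1) hsum
    obtain ⟨A, hA, hAv⟩ := ih _ hcard hyt rfl
    refine ⟨A, hA, fun i => ?_⟩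
    have hext : multilinearExt (v i) (y i) ≤ multilinearExt (v i) ((y + t • z) i) := by
      rcases hz i with h | ⟨α, β, j, k, hα, hβ, h, hD⟩
      · simp [h]
      · have e : (y + t • z) i = y i + (Pi.single j (t * α) - Pi.single k (t * β)) := by
          rw [Pi.add_apply, Pi.smul_apply, h, smul_sub, ← Pi.single_smul, ← Pi.single_smul,
            smul_eq_mul, smul_eq_mul]
        rw [e]
        have h1 := (hv i).le_multilinearExt_exchange (hy.nonneg i) (hy.le_one i) j k
          (mul_nonneg ht hα) (mul_nonneg ht hβ)
        have h2 := mul_nonneg ht hD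
        linarith
    refine (hAv i).imp hext.trans fun ⟨⟨m, hm⟩, h⟩ => ⟨?_, by linarith⟩
    by_cases hzi : z i m = 0
    · exact ⟨m, by simpa [hzi] using hm⟩
    · exact ⟨m, hzE i m hzi⟩

end Rounding

theorem mainTheorem8 {N M : Type*} [Fintype N] [Nonempty N] [Fintype M] [DecidableEq M]
    (v : N → Finset M → ℝ) (hv : ∀ i, IsValuation (v i)) (ε : ℝ)
    (hsmall : ∀ (i : N) (j : M), v i {j} ≤ ε * maximinShare N (v i)) :
    ∃ A : N → Finset M, IsAllocation A ∧
      ∀ i : N, (1 - 1 / Real.exp 1 - ε) * maximinShare N (v i) ≤ v i (A i) := by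
  have hy : IsFractionalAllocation fun (_ : N) (_ : M) => 1 / (Fintype.card N : ℝ) :=
    ⟨fun _ _ => by positivity, fun _ => by simp⟩
  obtain ⟨A, hA, hAv⟩ := hy.exists_rounding hv hsmall
  refine ⟨A, hA, fun i => ?_⟩
  obtain ⟨⟨P, hP, hmem, hleast⟩, -⟩ := maximinShare_isGreatest N (v i)
  have hunif := (hv i).le_multilinearExt_uniform hP fun k => hleast ⟨k, rfl⟩
  -- The sign of `ε` is not assumed. With an item, the product bounds a nonnegative value; without
  -- items the share is zero.
  have hε : 0 ≤ ε * maximinShare N (v i) := by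
    rcases isEmpty_or_nonempty M with hM | ⟨⟨j⟩⟩
    · obtain ⟨k, hk⟩ := hmem
      rw [← hk]
      simp [Finset.eq_empty_of_isEmpty, (hv i).empty]
    · exact ((hv i).nonneg {j}).trans (hsmall i j)
  rcases hAv i with h | ⟨-, h⟩ <;> linarith
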